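/- **Setting.** Let $G$ be the infinite triangular grid. A *shape* is a finite set $S$ of points of $G$. Its *outer face* consists of the points outside $S$ lying in an infinite connected component of $G\setminus S$; the other points outside $S$ are its *hole points*, and its *area* is $S$ together with its hole points. A point $v\in S$ is *erodable* w.r.t. $S$ if the neighbors of $v$ in $S$ induce a connected graph and $v$ is adjacent to a point of the outer face. An erodable point of a connected shape with at least two points has exactly one *local boundary* $B$ (a maximal cyclic interval of incident edges leading outside $S$); it is *SCE* (strictly convex and erodable) if $|B|-2>0$. A finite set of particles moves on $G$. Each particle is *contracted* (it occupies one point, its head and its tail) or *expanded* (it occupies two adjacent points, its head and its tail). Each particle numbers the six directions clockwise by ports $0,\dots,5$, starting from an arbitrary direction of its own. Its memory consists of a read-only input $outer[0..5]$, a variable $status\in\{undecided,leader,follower\}$, flags $eligible[0..5]$, and whether it has terminated. Initially the particles are contracted and occupy distinct points, forming a non-empty connected shape $S_P(C_0)$; $outer[i]$ is true iff the point reached via port $i$ is in the outer face of $S_P(C_0)$; $status=undecided$; $eligible[i]=\neg\,outer[i]$. The set $S_e$ of *eligible points* is initially the area of $S_P(C_0)$. **Algorithm DLE.** An execution is a sequence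 of atomic activations of arbitrary particles. A terminated particle does nothing. Otherwise an activated particle $p$ acts as follows. 1. If $p$ is expanded, it contracts into its head. 2. Otherwise, if $p$ is not undecided: it terminates if no neighboring particle is undecided, and does nothing if some neighboring particle is. 3. Otherwise $p$ is contracted at a point $v$ and undecided. If, according to its flags, no point adjacent to $v$ is eligible, $p$ becomes leader. Else, if $v$ is not SCE w.r.t. the eligible points (which $p$ decides from its flags), $p$ does nothing. Else $v$ is removed from $S_e$; for each neighboring particle $q$ whose head is adjacent to $v$, the flag of $q$ for the port leading from its head to $v$ is set to false; and then, if a point $u$ adjacent to $v$ is eligible and empty, $p$ expands into $u$ (head $u$, tail $v$) and sets its flag for the port leading from $u$ to $v$ to false and its five other flags to true; if there is no such $u$, $p$ becomes a follower. The algorithm has terminated once all particles have terminated. **Lemma.** Consider any execution of Algorithm DLE and any configuration $C_T$ of it in which the algorithm has terminated. Then there is exactly one particle with status leader; it is contracted, and the point $l$ that it occupies is the only eligible point left. Let $\epsilon_G(l)=\max_{u\in S_P(C_0)}dist_G(l,u)$ be the eccentricity of $l$ with respect to the initial shape and the grid distance. Then, in $C_T$: - for every $i\in\{0,\dots,\epsilon_G(l)\}$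 there is a contracted particle at grid distance $i$ from $l$; - no particle occupies a point at grid distance greater than $\epsilon_G(l)$ from $l$. -/

import Mathlib

namespace Amoebot

/-! ### The triangular grid -/

/-- Points of the infinite triangular grid `G`, in axial coordinates: `(a, b)` stands for the point
`a • e₁ + b • e₂` of the plane, where `e₁` is the unit vector pointing East and `e₂` is the unit
vector at angle 60 degrees with it. -/
abbrev Point : Type := ℤ × ℤ

/-- The six unit vectors of the grid, in clockwise order: E, SE, SW, W, NW, NE. -/
def dir : Fin 6 → Point :=
  ![(1, 0), (1, -1), (0, -1), (-1, 0), (-1, 1), (0, 1)]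

theorem dir_add_three (d : Fin 6) : dir (d + 3) = -dir d := by
  revert d; decide

theorem dir_ne_zero (d : Fin 6) : dir d ≠ 0 := by
  revert d; decide

/-- The triangular grid `G`. -/
def grid : SimpleGraph Point where
  Adj u v := ∃ d : Fin 6, v = u + dir d
  symm := ⟨by
    rintro u v ⟨d, rfl⟩
    exact ⟨d + 3, by rw [dir_add_three]; abel⟩⟩
  loopless := ⟨by
    rintro u ⟨d, hd⟩
    exact dir_ne_zero d (by simpa using hd.symm)⟩

/-! ### Shapes -/

/-- The points of the outer face of a (finite) shape `S`: the points outside of `S` that are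
connected, through points outside of `S`, to infinitely many points. -/
def outerFace (S : Set Point) : Set Point :=
  {u | ∃ hu : u ∈ Sᶜ, {w : ↥Sᶜ | (grid.induce Sᶜ).Reachable ⟨u, hu⟩ w}.Infinite}

/-- The hole points of `S`: the points outside of `S` that are not in the outer face. -/
def holePoints (S : Set Point) : Set Point := {u | u ∉ S ∧ u ∉ outerFace S}

/-- The area of a shape: the shape together with its hole points. -/
def area (S : Set Point) : Set Point := S ∪ holePoints S

/-- The outer boundary of `S`: the points of `S` that lie on the outer face. -/
def outerBoundary (S : Set Point) : Set Point :=
  {v | v ∈ S ∧ ∃ u, grid.Adj v u ∧ u ∈ outerFace S}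

/-- The eccentricity, w.r.t. the whole grid, of the point `v`: the greatest grid distance from `v`
to a point of the (finite) shape `S`. -/
noncomputable def gridEccentricity (S : Set Point) (v : Point) : ℕ :=
  sSup ((fun u => grid.dist v u) '' S)

/-- `v` is redundant in `S`: removing `v` does not disconnect its 1-hop neighborhood in `S`. -/
def IsRedundant (S : Set Point) (v : Point) : Prop :=
  v ∈ S ∧ (grid.induce {u | u ∈ S ∧ grid.Adj v u}).Preconnected

/-- `v` is erodable w.r.t. `S`: it is redundant and on the outer boundary. -/
def IsErodable (S : Set Point) (v : Point) : Prop :=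
  IsRedundant S v ∧ v ∈ outerBoundary S

/-- `B` (a set of directions, i.e. of edges incident to `v`) is a local boundary of `v` w.r.t. `S`:
a clockwise cyclic interval of `k` consecutive edges, starting at direction `i`, that lead to points
not in `S`, whose predecessor and successor edges lead to points of `S`. -/
def IsLocalBoundary (S : Set Point) (v : Point) (B : Finset (Fin 6)) : Prop :=
  ∃ (i : Fin 6) (k : Fin 6), 1 ≤ k ∧
    B = (Finset.univ.filter (fun j : Fin 6 => j < k)).image (fun j => i + j) ∧
    (∀ d ∈ B, v + dir d ∉ S) ∧ v + dir (i - 1) ∈ S ∧ v + dir (i + k) ∈ S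

/-- The boundary count of a local boundary. -/
def boundaryCount (B : Finset (Fin 6)) : ℤ := (B.card : ℤ) - 2

/-- `v` is strictly convex and erodable (SCE) w.r.t. `S`: it is erodable, and strictly convex w.r.t.
its local boundary (an erodable point of a shape with at least two points has exactly one). -/
def IsSCE (S : Set Point) (v : Point) : Prop :=
  IsErodable S v ∧ ∃ B, IsLocalBoundary S v B ∧ 0 < boundaryCount B

/-- For a shape `S` without holes, whether a point `v` of `S` is SCE only depends on `v` and on its
neighbors in `S`, so that a particle occupying `v` can decide it. -/
theorem isSCE_iff_local {S : Set Point} (hS : outerFace S = Sᶜ) {v : Point} (hv : v ∈ S) :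
    IsSCE S v ↔ IsSCE {x | x = v ∨ (grid.Adj v x ∧ x ∈ S)} v := by
  set L : Set Point := {x | x = v ∨ (grid.Adj v x ∧ x ∈ S)} with hL
  have hmem : ∀ u, grid.Adj v u → (u ∈ L ↔ u ∈ S) := by
    intro u hu
    constructor
    · rintro (rfl | h)
      · exact hv
      · exact h.2
    · exact fun h => Or.inr ⟨hu, h⟩
  have hmem' : ∀ d, v + dir d ∈ L ↔ v + dir d ∈ S := fun d => hmem _ ⟨d, rfl⟩
  have hred : IsRedundant S v ↔ IsRedundant L v := by
    have : {u | u ∈ S ∧ grid.Adj v u} = {u | u ∈ L ∧ grid.Adj v u} := by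
      ext u
      constructor
      · exact fun h => ⟨(hmem u h.2).2 h.1, h.2⟩
      · exact fun h => ⟨(hmem u h.2).1 h.1, h.2⟩
    unfold IsRedundant
    rw [this]
    exact and_congr_left fun _ => ⟨fun _ => Or.inl rfl, fun _ => hv⟩
  have hout : v ∈ outerBoundary S ↔ v ∈ outerBoundary L := by
    constructor
    · rintro ⟨-, u, ⟨d, rfl⟩, hu⟩
      have huS : v + dir d ∉ S := hu.1
      refine ⟨Or.inl rfl, _, ⟨d, rfl⟩, ?_⟩
      -- the ray from `v` through `u` avoids `L`
      have hray : ∀ k : ℕ, v + (k + 1) • dir d ∈ Lᶜ := by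
        rintro k (h | ⟨⟨e, h⟩, h'⟩)
        · have : (k + 1) • dir d = 0 := by simpa using h
          exact (smul_ne_zero (Nat.succ_ne_zero k) (dir_ne_zero d)) this
        · have h2 : (k + 1) • dir d = dir e := by simpa using h
          have hk : k = 0 := by
            have a1 := congrArg Prod.fst h2
            have a2 := congrArg Prod.snd h2
            fin_cases d <;> fin_cases e <;> simp [dir] at a1 a2 <;> omega
          subst hk
          exact huS (by simpa using h')
      have hreach : ∀ k : ℕ, (grid.induce Lᶜ).Reachable
          ⟨v + (0 + 1) • dir d, hray 0⟩ ⟨v + (k + 1) • dir d, hray k⟩ := by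
        intro k
        induction k with
        | zero => exact SimpleGraph.Reachable.refl _
        | succ k ih =>
          refine ih.trans (SimpleGraph.Adj.reachable ?_)
          exact ⟨d, by simp only [Function.Embedding.subtype_apply]; rw [succ_nsmul _ (k + 1)]; abel⟩
      have h1 : v + dir d = v + (0 + 1) • dir d := by simp
      rw [h1]
      refine ⟨hray 0, ?_⟩
      refine (Set.infinite_range_of_injective
        (f := fun k : ℕ => (⟨v + (k + 1) • dir d, hray k⟩ : ↥Lᶜ)) ?_).mono ?_
      · intro k m hkm
        have h2 : (k + 1) • dir d = (m + 1) • dir d := by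
          simpa using congrArg Subtype.val hkm
        have a1 := congrArg Prod.fst h2
        have a2 := congrArg Prod.snd h2
        fin_cases d <;> simp [dir] at a1 a2 <;> omega
      · rintro _ ⟨k, rfl⟩
        exact hreach k
    · rintro ⟨-, u, hu, huo⟩
      have : u ∉ S := fun h => huo.1 ((hmem u hu).2 h)
      exact ⟨hv, u, hu, by rw [hS]; exact this⟩
  unfold IsSCE IsErodable IsLocalBoundary
  simp only [hred, hout, hmem']

/-! ### Particles and configurations -/

/-- Values of the output variable `status`. -/
inductive Status
  | undecided
  | leader
  | follower

/-- The occupied points and the memory of a particle. `outer` is the read-only input; `terminated`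
records that the particle has executed the instruction "terminate". -/
structure ParticleState where
  head : Point
  tail : Point
  outer : Fin 6 → Bool
  status : Status
  eligible : Fin 6 → Bool
  terminated : Bool

/-- A particle is contracted if it occupies a single point (otherwise it is expanded). -/
def ParticleState.Contracted (s : ParticleState) : Prop := s.head = s.tail

/-- The points occupied by a particle. -/
def ParticleState.occupied (s : ParticleState) : Set Point := {s.head, s.tail}

/-- A configuration of a system with set of particles `P`, together with the set `Se` of eligible
points. `Se` is bookkeeping: the particles never read it. -/
structure Config (P : Type*) where
  state : P → ParticleState
  Se : Set Point

variable {P : Type*}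

/-- The shape of the particle system: the set of occupied points. -/
def Config.shape (C : Config P) : Set Point := {x | ∃ p, x ∈ (C.state p).occupied}

/-- The set of the neighboring particles of `p`. -/
def Config.neighbors (C : Config P) (p : P) : Set P :=
  {q | q ≠ p ∧ ∃ x ∈ (C.state p).occupied, ∃ y ∈ (C.state q).occupied, grid.Adj x y}

/-- The point that particle `p` reaches from the point `u` via its port `i`. All particles number
their ports clockwise (common chirality); the direction `off p` of port `0` is arbitrary. -/
def viaPort (off : P → Fin 6) (p : P) (u : Point) (i : Fin 6) : Point := u + dir (off p + i)

/-- What particle `p` knows about the eligible points around its head `v`, according to its flags: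
the point `v` and the points reached from `v` via a port whose `eligible` flag is true. -/
def Config.view (off : P → Fin 6) (C : Config P) (p : P) : Set Point :=
  {x | x = (C.state p).head ∨
    ∃ i, (C.state p).eligible i = true ∧ x = viaPort off p (C.state p).head i}

open Classical in
/-- The states of the particles after `p`, contracted at the point `v`, has told its neighboring
particles that `v` is no longer eligible: for every `q ∈ N(p)` whose head `w` is adjacent to `v`,
the flag `q.eligible[port(q, w, v)]` is set to false. -/
noncomputable def Config.notify (off : P → Fin 6) (C : Config P) (p : P) (v : Point) :
    P → ParticleState := fun q =>
  if q ∈ C.neighbors p ∧ grid.Adj (C.state q).head v then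
    { C.state q with
      eligible := fun i =>
        if viaPort off q (C.state q).head i = v then false else (C.state q).eligible i }
  else C.state q

/-! ### Algorithm DLE -/

open Classical in
/-- `Activation off p C C'`: in the configuration `C`, an atomic activation of the particle `p`
executing Algorithm DLE can result in the configuration `C'`. -/
inductive Activation (off : P → Fin 6) (p : P) (C : Config P) : Config P → Prop
  /-- A particle that has terminated does nothing. -/
  | final (h : (C.state p).terminated = true) : Activation off p C C
  /-- If `p` is expanded, `p` contracts into its head. -/
  | contract (h : (C.state p).terminated = false) (hexp : ¬ (C.state p).Contracted) :
      Activation off p C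
        { C with
          state := Function.update C.state p { C.state p with tail := (C.state p).head } }
  /-- If `p` and all its neighboring particles have decided, then `p` terminates. -/
  | terminate (h : (C.state p).terminated = false) (hcon : (C.state p).Contracted)
      (hdec : (C.state p).status ≠ Status.undecided)
      (hnbr : ∀ q ∈ C.neighbors p, (C.state q).status ≠ Status.undecided) :
      Activation off p C
        { C with state := Function.update C.state p { C.state p with terminated := true } }
  /-- If `p` has decided but some neighboring particle has not, then `p` does nothing. -/
  | wait (h : (C.state p).terminated = false) (hcon : (C.state p).Contracted)
      (hdec : (C.state p).status ≠ Status.undecided)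
      (hnbr : ∃ q ∈ C.neighbors p, (C.state q).status = Status.undecided) :
      Activation off p C C
  /-- If no point adjacent to that of `p` is eligible, then `p` becomes the leader. -/
  | elect (h : (C.state p).terminated = false) (hcon : (C.state p).Contracted)
      (hund : (C.state p).status = Status.undecided)
      (hno : ∀ i, (C.state p).eligible i = false) :
      Activation off p C
        { C with state := Function.update C.state p { C.state p with status := Status.leader } }
  /-- Some adjacent point is eligible, and the point of `p` is not SCE: `p` does nothing. -/
  | skip (h : (C.state p).terminated = false) (hcon : (C.state p).Contracted)
      (hund : (C.state p).status = Status.undecided)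
      (hyes : ∃ i, (C.state p).eligible i = true)
      (hsce : ¬ IsSCE (C.view off p) (C.state p).head) :
      Activation off p C C
  /-- The point `v` of `p` is SCE, and the point `u` reached via port `i` is eligible and empty:
  `p` removes `v` from `Se`, notifies its neighbors, and expands into `u`. -/
  | erodeExpand (h : (C.state p).terminated = false) (hcon : (C.state p).Contracted)
      (hund : (C.state p).status = Status.undecided)
      (hyes : ∃ i, (C.state p).eligible i = true)
      (hsce : IsSCE (C.view off p) (C.state p).head)
      (i : Fin 6) (hel : (C.state p).eligible i = true)
      (hempty : viaPort off p (C.state p).head i ∉ C.shape) :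
      Activation off p C
        { state := Function.update (C.notify off p (C.state p).head) p
            { C.state p with
              head := viaPort off p (C.state p).head i
              tail := (C.state p).head
              eligible := fun j => if j = i + 3 then false else true }
          Se := C.Se \ {(C.state p).head} }
  /-- The point `v` of `p` is SCE, and no adjacent point is both eligible and empty: `p` removes `v`
  from `Se`, notifies its neighbors, and becomes a follower. -/
  | erodeStay (h : (C.state p).terminated = false) (hcon : (C.state p).Contracted)
      (hund : (C.state p).status = Status.undecided)
      (hyes : ∃ i, (C.state p).eligible i = true)
      (hsce : IsSCE (C.view off p) (C.state p).head)
      (hocc : ∀ i, (C.state p).eligible i = true → viaPort off p (C.state p).head i ∈ C.shape) :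
      Activation off p C
        { state := Function.update (C.notify off p (C.state p).head) p
            { C.state p with status := Status.follower }
          Se := C.Se \ {(C.state p).head} }

/-- Initial configurations of Algorithm DLE: distinct particles occupy distinct points, the system
is contracted, non-empty and connected, `outer[i]` tells whether the point reached via port `i` is in
the outer face of the shape, the other variables are initialized as in the algorithm, and the
eligible points are those of the area of the shape. -/
structure IsInitial (off : P → Fin 6) (C : Config P) : Prop where
  injective : Function.Injective (fun p => (C.state p).head)
  contracted : ∀ p, (C.state p).Contracted
  nonempty : C.shape.Nonempty
  connected : (grid.induce C.shape).Connected
  outer : ∀ p i, (C.state p).outer i = true ↔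
    viaPort off p (C.state p).head i ∈ outerFace C.shape
  status : ∀ p, (C.state p).status = Status.undecided
  eligible : ∀ p i, (C.state p).eligible i = !(C.state p).outer i
  terminated : ∀ p, (C.state p).terminated = false
  Se : C.Se = area C.shape

/-- An execution of Algorithm DLE: `C t` is the configuration after `t` activations, and `a t` is
the particle whose activation leads from `C t` to `C (t + 1)`. -/
structure IsExecution (off : P → Fin 6) (C : ℕ → Config P) (a : ℕ → P) : Prop where
  initial : IsInitial off (C 0)
  step : ∀ t, Activation off (a t) (C t) (C (t + 1))

/-- The algorithm has terminated in the configuration `C`. -/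
def Config.Terminated (C : Config P) : Prop := ∀ p, (C.state p).terminated = true

end Amoebot

namespace Amoebot

/-! The eligible set stays connected and inside the area of the initial shape, and every eligible
point with a non-eligible neighbor is the head of a particle (`Invariant`). So an empty eligible
point has all six neighbors eligible. An SCE point has at most three neighbors in the set, and these
are consecutive, so at most one of them is empty. If there is one, the eroding particle moves into
it, which restores the boundary condition (`Invariant.erode`). Some eligible point is always a head;
at termination its particle is decided and cannot be a follower, so it is a leader, and a leader
exists only when its point is the sole eligible one.

For the distances, fix `l` eligible at the end, hence eligible throughout. Each `i` up to the
eccentricity remains the distance from `l` of an eligible point or of a follower (`Marked.step`).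
Indeed, when the last eligible point `v` at distance `i` is erased, connectedness puts all remaining
eligible points strictly closer to `l`. If the particle stays, it is a follower at distance `i`. It
cannot expand: its target and the two common neighbors of `v` and the target would be three
consecutive neighbors of `v`, all strictly closer to `l`, against `exists_hexNorm_le_add_dir`.

No particle goes too far because particles never leave the area, and filling holes does not increase
the eccentricity (`dist_le_gridEccentricity`). -/

/-! ### The grid distance -/

/-- The grid distance of a point to the origin. -/
def hexNorm (x : Point) : ℕ := max (max x.1.natAbs x.2.natAbs) (x.1 + x.2).natAbs

theorem hexNorm_add_dir_le (x : Point) (d : Fin 6) : hexNorm (x + dir d) ≤ hexNorm x + 1 := by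
  obtain ⟨a, b⟩ := x
  fin_cases d <;> simp [hexNorm, dir] <;> omega

theorem exists_hexNorm_add_dir_lt {x : Point} (hx : x ≠ 0) :
    ∃ d, hexNorm (x + dir d) + 1 = hexNorm x := by
  obtain ⟨a, b⟩ := x
  have h0 : a ≠ 0 ∨ b ≠ 0 := by
    by_contra h
    push Not at h
    exact hx (by simp [h.1, h.2])
  -- Overlapping sectors covering the plane minus the origin; in each, a single direction decreases
  -- the norm throughout.
  have hcases : (1 ≤ a ∧ 0 ≤ b) ∨ (a ≤ -1 ∧ b ≤ 0) ∨ (0 ≤ a ∧ 1 ≤ b) ∨ (a ≤ 0 ∧ b ≤ -1) ∨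
      (1 ≤ a ∧ b ≤ -1) ∨ (a ≤ -1 ∧ 1 ≤ b) := by omega
  rcases hcases with h | h | h | h | h | h
  · exact ⟨3, by simp [hexNorm, dir]; omega⟩
  · exact ⟨0, by simp [hexNorm, dir]; omega⟩
  · exact ⟨2, by simp [hexNorm, dir]; omega⟩
  · exact ⟨5, by simp [hexNorm, dir]; omega⟩
  · exact ⟨4, by simp [hexNorm, dir]; omega⟩
  · exact ⟨1, by simp [hexNorm, dir]; omega⟩

/-- The norm is a maximum of three absolute values of linear forms; a direction that pushes a
maximal one away from zero works for every `k`. -/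
theorem exists_hexNorm_le_ray (x : Point) : ∃ d, ∀ k : ℕ, hexNorm x ≤ hexNorm (x + k • dir d) := by
  obtain ⟨a, b⟩ := x
  by_contra h
  push Not at h
  obtain ⟨k0, h0⟩ := h 0
  obtain ⟨k1, h1⟩ := h 1
  obtain ⟨k2, h2⟩ := h 2
  obtain ⟨k3, h3⟩ := h 3
  obtain ⟨k4, h4⟩ := h 4
  obtain ⟨k5, h5⟩ := h 5
  simp [hexNorm, dir] at h0 h1 h2 h3 h4 h5
  omega

/-- Of three consecutive neighbors of a point, one is at least as far from the origin. -/
theorem exists_hexNorm_le_add_dir (x : Point) (d : Fin 6) :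
    hexNorm x ≤ hexNorm (x + dir (d - 1)) ∨ hexNorm x ≤ hexNorm (x + dir d) ∨
      hexNorm x ≤ hexNorm (x + dir (d + 1)) := by
  obtain ⟨a, b⟩ := x
  by_contra h
  push Not at h
  obtain ⟨h1, h2, h3⟩ := h
  have e : ∀ j : Fin 6, dir j = (![1, 1, 0, -1, -1, 0] j, ![0, -1, -1, 0, 1, 1] j) := by decide
  rw [e] at h1 h2 h3
  fin_cases d <;> simp [hexNorm] at h1 h2 h3 <;> omega

theorem hexNorm_sub_le_length {l x : Point} (w : grid.Walk l x) :
    hexNorm (x - l) ≤ w.length := by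
  induction w with
  | nil => simp [hexNorm]
  | @cons u v w h p ih =>
    obtain ⟨d, hd⟩ := id h
    have := hexNorm_add_dir_le (w - v) d
    rw [hd, show w - (u + dir d) + dir d = w - u by abel, ← hd] at this
    rw [SimpleGraph.Walk.length_cons]
    omega

theorem exists_walk_length_eq_hexNorm (n : ℕ) :
    ∀ l x : Point, hexNorm (x - l) = n → ∃ w : grid.Walk l x, w.length = n := by
  induction n with
  | zero =>
    intro l x h
    have : x = l := by
      simp [hexNorm] at h
      ext <;> omega
    subst this
    exact ⟨.nil, rfl⟩
  | succ n ih =>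
    intro l x h
    have hx : x - l ≠ 0 := by
      intro h0
      simp [h0, hexNorm] at h
    obtain ⟨d, hd⟩ := exists_hexNorm_add_dir_lt hx
    have hadj : grid.Adj l (l - dir d) := ⟨d + 3, by rw [dir_add_three]; abel⟩
    obtain ⟨w, hw⟩ := ih (l - dir d) x (by
      rw [show x - (l - dir d) = x - l + dir d by abel]; omega)
    exact ⟨.cons hadj w, by simp [hw]⟩

theorem dist_eq_hexNorm (l x : Point) : grid.dist l x = hexNorm (x - l) := by
  obtain ⟨w, hw⟩ := exists_walk_length_eq_hexNorm _ l x rfl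
  refine le_antisymm (hw ▸ SimpleGraph.dist_le w) ?_
  obtain ⟨w', hw'⟩ := w.reachable.exists_walk_length_eq_dist
  exact hw' ▸ hexNorm_sub_le_length w'

theorem dist_self_add_dir_le (l x : Point) (d : Fin 6) :
    grid.dist l (x + dir d) ≤ grid.dist l x + 1 := by
  rw [dist_eq_hexNorm, dist_eq_hexNorm, show x + dir d - l = x - l + dir d by abel]
  exact hexNorm_add_dir_le _ _

/-! ### Connectedness by cuts -/

/-- `S` is connected: a set that meets `S` and is closed under adjacency within `S` contains `S`. -/
def CutConnected (S : Set Point) : Prop :=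
  ∀ A : Set Point, (∃ x ∈ S, x ∈ A) →
    (∀ x ∈ S, x ∈ A → ∀ y ∈ S, grid.Adj x y → y ∈ A) → S ⊆ A

theorem cutConnected_of_preconnected {S : Set Point} (h : (grid.induce S).Preconnected) :
    CutConnected S := by
  rintro A ⟨x, hxS, hxA⟩ hcl y hyS
  obtain ⟨w⟩ := h ⟨x, hxS⟩ ⟨y, hyS⟩
  suffices ∀ a b : S, (grid.induce S).Walk a b → a.1 ∈ A → b.1 ∈ A from this _ _ w hxA
  intro a b w
  induction w with
  | nil => exact id
  | @cons u v w h p ih => exact fun hu => ih (hcl u u.2 hu v v.2 h)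

/-- Erasing a redundant point preserves connectedness. -/
theorem CutConnected.diff_singleton {S : Set Point} (hS : CutConnected S) {v : Point}
    (hv : IsRedundant S v) : CutConnected (S \ {v}) := by
  rintro A ⟨x, ⟨hxS, hxv⟩, hxA⟩ hcl
  -- If `A` meets the neighborhood of `v`, redundancy puts the whole neighborhood in `A`, and
  -- `insert v A` is closed in `S`. Otherwise `A \ {v}` is closed in `S`, hence would contain `v`.
  by_cases hN : ∃ y ∈ S, grid.Adj v y ∧ y ∈ A
  · obtain ⟨y, hyS, hvy, hyA⟩ := hN
    have hall := cutConnected_of_preconnected hv.2 A ⟨y, ⟨hyS, hvy⟩, hyA⟩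
      (fun a ha haA b hb hab => hcl a ⟨ha.1, ha.2.ne'⟩ haA b ⟨hb.1, hb.2.ne'⟩ hab)
    have := hS (insert v A) ⟨x, hxS, Or.inr hxA⟩ (by
      intro a ha haA b hb hab
      by_cases hbv : b = v
      · exact Or.inl hbv
      refine Or.inr ?_
      by_cases hav : a = v
      · exact hall ⟨hb, hav ▸ hab⟩
      · exact hcl a ⟨ha, hav⟩ (haA.resolve_left hav) b ⟨hb, hbv⟩ hab)
    exact fun a ha => (this ha.1).resolve_left ha.2
  · push Not at hN
    have := hS (A \ {v}) ⟨x, hxS, hxA, hxv⟩ (by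
      rintro a ha ⟨haA, hav⟩ b hb hab
      have hbv : b ≠ v := by
        rintro rfl
        exact hN a ha hab.symm haA
      exact ⟨hcl a ⟨ha, hav⟩ haA b ⟨hb, hbv⟩ hab, hbv⟩)
    exact absurd rfl (this hv.1).2

/-- A connected set containing `l` has no gap in the distances of its points to `l`. -/
theorem CutConnected.dist_lt {S : Set Point} (hS : CutConnected S) {l : Point} (hl : l ∈ S)
    {i : ℕ} (hi : ∀ x ∈ S, grid.dist l x ≠ i) {x : Point} (hx : x ∈ S) : grid.dist l x < i := by
  -- A step raises the distance by at most one, so it cannot jump over the missing value `i`; and `i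
  -- ≠ 0` because `l` is at distance 0.
  refine hS {x | grid.dist l x < i} ⟨l, hl, ?_⟩ ?_ hx
  · have := hi l hl
    rw [SimpleGraph.dist_self] at this
    simp only [Set.mem_ofPred_eq, SimpleGraph.dist_self]
    omega
  · rintro a - ha y hy ⟨d, rfl⟩
    have h1 := hi _ hy
    have h2 := dist_self_add_dir_le l a d
    simp only [Set.mem_ofPred_eq] at ha ⊢
    omega

/-! ### The area of a shape -/

theorem mem_outerFace_of_adj {S : Set Point} {u w : Point} (hu : u ∉ S) (huw : grid.Adj u w)
    (hw : w ∈ outerFace S) : u ∈ outerFace S := by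
  obtain ⟨hwS, hinf⟩ := hw
  refine ⟨hu, hinf.mono fun z hz => ?_⟩
  have hadj : (grid.induce Sᶜ).Adj ⟨u, hu⟩ ⟨w, hwS⟩ := huw
  exact hadj.reachable.trans hz

theorem mem_outerFace_of_ray {S : Set Point} {x : Point} {d : Fin 6}
    (h : ∀ k : ℕ, x + k • dir d ∉ S) : x ∈ outerFace S := by
  have h0 : x ∉ S := by simpa using h 0
  refine ⟨h0, (Set.infinite_range_of_injective
    (f := fun k : ℕ => (⟨x + k • dir d, h k⟩ : ↥Sᶜ)) ?_).mono ?_⟩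
  · intro k m hkm
    have h2 : k • dir d = m • dir d := by simpa using congrArg Subtype.val hkm
    have a1 := congrArg Prod.fst h2
    have a2 := congrArg Prod.snd h2
    fin_cases d <;> simp [dir] at a1 a2 <;> omega
  · rintro _ ⟨k, rfl⟩
    induction k with
    | zero => simp
    | succ k ih =>
      refine SimpleGraph.Reachable.trans ih (SimpleGraph.Adj.reachable ?_)
      exact ⟨d, by simp only [Function.Embedding.subtype_apply]; rw [succ_nsmul]; abel⟩

theorem mem_area_iff {S : Set Point} {x : Point} : x ∈ area S ↔ x ∉ outerFace S := by
  constructor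
  · rintro (h | h)
    · exact fun h' => h'.1 h
    · exact h.2
  · intro h
    by_cases hx : x ∈ S
    · exact Or.inl hx
    · exact Or.inr ⟨hx, h⟩

/-- The area can be left only through `S`, since a point off `S` next to the outer face is itself in
the outer face. -/
theorem mem_of_mem_area_of_adj {S : Set Point} {x y : Point} (hx : x ∈ area S)
    (hxy : grid.Adj x y) (hy : y ∉ area S) : x ∈ S := by
  by_contra hxS
  rw [mem_area_iff] at hx hy
  exact hx (mem_outerFace_of_adj hxS hxy (not_not.1 hy))

theorem cutConnected_area {S : Set Point} (hS : CutConnected S) : CutConnected (area S) := by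
  -- A part of the area closed under adjacency meets `S`: otherwise the eastward ray from one of its
  -- points never exits the area nor hits `S`, which places that point in the outer face. Used for
  -- `A` and then for its complement.
  have key : ∀ A : Set Point, (∃ x ∈ area S, x ∈ A) →
      (∀ x ∈ area S, x ∈ A → ∀ y ∈ area S, grid.Adj x y → y ∈ A) → ∃ x ∈ S, x ∈ A := by
    rintro A ⟨x, hx, hxA⟩ hcl
    by_contra hno
    push Not at hno
    have hray : ∀ k : ℕ, x + k • dir 0 ∈ area S ∧ x + k • dir 0 ∈ A := by
      intro k
      induction k with
      | zero => simpa using ⟨hx, hxA⟩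
      | succ k ih =>
        have hadj : grid.Adj (x + k • dir 0) (x + (k + 1) • dir 0) :=
          ⟨0, by rw [succ_nsmul]; abel⟩
        have harea : x + (k + 1) • dir 0 ∈ area S := by
          by_contra h
          exact hno _ (mem_of_mem_area_of_adj ih.1 hadj h) ih.2
        exact ⟨harea, hcl _ ih.1 ih.2 _ harea hadj⟩
    exact mem_area_iff.1 hx (mem_outerFace_of_ray fun k hk => hno _ hk (hray k).2)
  intro A hA hcl
  have hSA : S ⊆ A := hS A (key A hA hcl) fun x hx hxA y hy hxy =>
    hcl x (Or.inl hx) hxA y (Or.inl hy) hxy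
  by_contra hne
  obtain ⟨z, hz, hzA⟩ := Set.not_subset.1 hne
  obtain ⟨x, hx, hxA⟩ := key Aᶜ ⟨z, hz, hzA⟩ fun x hx hxA y hy hxy hyA =>
    hxA (hcl y hy hyA x hx hxy.symm)
  exact hxA (hSA hx)

/-- From a point of the area, a ray along which the distance to `l` never drops below its initial
value must hit `S`. Finiteness makes the `sSup` a true upper bound. -/
theorem dist_le_gridEccentricity {S : Set Point} (hS : S.Finite) (l : Point) {x : Point}
    (hx : x ∈ area S) : grid.dist l x ≤ gridEccentricity S l := by
  have hbound : ∀ y ∈ S, grid.dist l y ≤ gridEccentricity S l := fun y hy =>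
    le_csSup (hS.image _).bddAbove ⟨y, hy, rfl⟩
  by_contra hlt
  push Not at hlt
  obtain ⟨d, hd⟩ := exists_hexNorm_le_ray (x - l)
  refine mem_area_iff.1 hx (mem_outerFace_of_ray (d := d) fun k hk => ?_)
  have h1 := hbound _ hk
  have h2 := hd k
  rw [dist_eq_hexNorm] at h1 hlt
  rw [show x + k • dir d - l = x - l + k • dir d by abel] at h1
  omega

theorem exists_dist_eq_gridEccentricity {S : Set Point} (hS : S.Finite) (hne : S.Nonempty)
    (l : Point) : ∃ x ∈ S, grid.dist l x = gridEccentricity S l :=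
  (hne.image _).csSup_mem (hS.image fun u => grid.dist l u)

/-! ### Strictly convex and erodable points -/

/-- A positive boundary count means at least three consecutive edges, starting at `i`, lead outside.
Only `i + 3`, `i + 4`, `i + 5` can lead inside, so three consecutive inner neighbors are centered at
`i + 4`. -/
theorem IsSCE.eq_of_three_neighbors {S : Set Point} {v : Point} (h : IsSCE S v) :
    ∃ c : Fin 6, ∀ d, v + dir (d - 1) ∈ S → v + dir d ∈ S → v + dir (d + 1) ∈ S → d = c := by
  obtain ⟨-, B, ⟨i, k, -, hB, hout, -, -⟩, hcount⟩ := h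
  have hk : 3 ≤ k := by
    have hle : B.card ≤ (Finset.univ.filter (fun j : Fin 6 => j < k)).card :=
      hB ▸ Finset.card_image_le
    have : 3 ≤ B.card := by
      unfold boundaryCount at hcount
      omega
    have h3 := this.trans hle
    revert h3
    clear * -
    revert k
    decide
  have hmem : ∀ j : Fin 6, j < 3 → v + dir (i + j) ∉ S := fun j hj =>
    hout _ (hB ▸ Finset.mem_image_of_mem _ (by simpa using lt_of_lt_of_le hj hk))
  refine ⟨i + 4, fun d h1 h2 h3 => ?_⟩
  have aux : ∀ i d : Fin 6, d ≠ i + 4 → ∃ j : Fin 6, j < 3 ∧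
      (i + j = d - 1 ∨ i + j = d ∨ i + j = d + 1) := by decide
  by_contra hne
  obtain ⟨j, hj, hj'⟩ := aux i d hne
  have := hmem j hj
  rcases hj' with e | e | e <;> rw [e] at this <;> contradiction

theorem adj_add_dir (v : Point) (d : Fin 6) :
    grid.Adj (v + dir d) (v + dir (d - 1)) ∧ grid.Adj (v + dir d) (v + dir (d + 1)) := by
  have h1 : ∀ d : Fin 6, dir (d - 1) = dir d + dir (d - 2) := by decide
  have h2 : ∀ d : Fin 6, dir (d + 1) = dir d + dir (d + 2) := by decide
  exact ⟨⟨d - 2, by rw [h1, add_assoc]⟩, ⟨d + 2, by rw [h2, add_assoc]⟩⟩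

/-! ### Ports and notifications -/

variable {P : Type*} {off : P → Fin 6}

theorem adj_viaPort (off : P → Fin 6) (p : P) (u : Point) (i : Fin 6) :
    grid.Adj u (viaPort off p u i) := ⟨_, rfl⟩

theorem exists_viaPort_eq (off : P → Fin 6) (p : P) {u w : Point} (h : grid.Adj u w) :
    ∃ i, viaPort off p u i = w := by
  obtain ⟨d, rfl⟩ := h
  exact ⟨d - off p, by simp [viaPort]⟩

theorem viaPort_viaPort_eq_iff (p : P) (v : Point) (i j : Fin 6) :
    viaPort off p (viaPort off p v i) j = v ↔ j = i + 3 := by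
  have aux : ∀ a i j : Fin 6, dir (a + i) + dir (a + j) = 0 ↔ j = i + 3 := by decide
  rw [← aux (off p) i j, viaPort, viaPort, add_assoc, add_eq_left]

variable {C : Config P} {p : P}

theorem Config.notify_head (v : Point) (q : P) :
    (C.notify off p v q).head = (C.state q).head := by
  unfold Config.notify; split_ifs <;> rfl

theorem Config.notify_tail (v : Point) (q : P) :
    (C.notify off p v q).tail = (C.state q).tail := by
  unfold Config.notify; split_ifs <;> rfl

theorem Config.notify_status (v : Point) (q : P) :
    (C.notify off p v q).status = (C.state q).status := by
  unfold Config.notify; split_ifs <;> rfl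

theorem Config.notify_terminated (v : Point) (q : P) :
    (C.notify off p v q).terminated = (C.state q).terminated := by
  unfold Config.notify; split_ifs <;> rfl

/-- The guard in `Config.notify` loses nothing: a particle with a port from its head to the head of
`p` is automatically a neighbor of `p` with adjacent head. -/
theorem Config.notify_eligible (q : P) (i : Fin 6) :
    (C.notify off p (C.state p).head q).eligible i = true ↔
      (C.state q).eligible i = true ∧
        viaPort off q (C.state q).head i ≠ (C.state p).head := by
  unfold Config.notify
  split_ifs with h
  · by_cases h' : viaPort off q (C.state q).head i = (C.state p).head <;> simp [h']
  · refine ⟨fun he => ⟨he, fun heq => h ?_⟩, fun he => he.1⟩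
    have hadj : grid.Adj (C.state q).head (C.state p).head := heq ▸ adj_viaPort off q _ i
    refine ⟨⟨?_, _, Or.inl rfl, _, Or.inl rfl, hadj.symm⟩, hadj⟩
    rintro rfl
    exact hadj.ne rfl

/-! ### The invariant -/

/-- The invariant of Algorithm DLE, for an initial shape `S`. -/
structure Invariant (off : P → Fin 6) (S : Set Point) (C : Config P) : Prop where
  conn : CutConnected C.Se
  subset : C.Se ⊆ area S
  flags : ∀ q i, (C.state q).eligible i = true ↔ viaPort off q (C.state q).head i ∈ C.Se
  -- Read contrapositively: an eligible point that is not a head has only eligible neighbors.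
  boundary : ∀ x ∈ C.Se, ∀ y ∉ C.Se, grid.Adj x y → ∃ q, (C.state q).head = x
  -- The tail of an expanded particle is a point it has erased.
  tail : ∀ q, (C.state q).tail ∈ C.Se → (C.state q).head = (C.state q).tail
  injective : ∀ q r, (C.state q).head = (C.state r).head → q = r
  undecided : ∀ q, (C.state q).status = Status.undecided → (C.state q).head ∈ C.Se
  leader : ∀ q, (C.state q).status = Status.leader → C.Se = {(C.state q).head}
  follower : ∀ q, (C.state q).status = Status.follower → (C.state q).head ∉ C.Se
  occupied : ∃ q, (C.state q).head ∈ C.Se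
  contracted : ∀ q, (C.state q).status ≠ Status.undecided → (C.state q).Contracted
  terminated : ∀ q, (C.state q).terminated = true → (C.state q).status ≠ Status.undecided
  head_mem : ∀ q, (C.state q).head ∈ area S
  tail_mem : ∀ q, (C.state q).tail ∈ area S

theorem Config.shape_eq_range (h : ∀ p, (C.state p).Contracted) :
    C.shape = Set.range fun p => (C.state p).head := by
  ext x
  constructor
  · rintro ⟨p, rfl | rfl⟩
    · exact ⟨p, rfl⟩
    · exact ⟨p, h p⟩
  · rintro ⟨p, rfl⟩
    exact ⟨p, Or.inl rfl⟩

theorem IsInitial.invariant (h : IsInitial off C) : Invariant off C.shape C := by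
  have hhead : ∀ q, (C.state q).head ∈ area C.shape := fun q => Or.inl ⟨q, Or.inl rfl⟩
  refine ⟨?_, h.Se.subset, ?_, ?_, fun q _ => h.contracted q, fun q r e => h.injective e, ?_, ?_, ?_,
    ?_, fun q _ => h.contracted q, ?_, hhead, fun q => h.contracted q ▸ hhead q⟩
  · rw [h.Se]
    exact cutConnected_area (cutConnected_of_preconnected h.connected.preconnected)
  · intro q i
    rw [h.eligible, h.Se, mem_area_iff, ← h.outer]
    simp
  · intro x hx y hy hxy
    rw [h.Se] at hx hy
    have := mem_of_mem_area_of_adj hx hxy hy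
    rwa [Config.shape_eq_range h.contracted] at this
  · exact fun q _ => h.Se ▸ hhead q
  · intro q hq
    rw [h.status] at hq
    cases hq
  · intro q hq
    rw [h.status] at hq
    cases hq
  · obtain ⟨x, q, -⟩ := h.nonempty
    exact ⟨q, h.Se ▸ hhead q⟩
  · intro q hq
    rw [h.terminated] at hq
    cases hq

namespace Invariant

variable {S : Set Point}

theorem exists_head_of_mem_shape (h : Invariant off S C) {x : Point} (hx : x ∈ C.Se)
    (hx' : x ∈ C.shape) : ∃ q, (C.state q).head = x := by
  obtain ⟨q, rfl | rfl⟩ := hx'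
  · exact ⟨q, rfl⟩
  · exact ⟨q, h.tail q hx⟩

/-- All the neighbors of an empty eligible point are eligible. -/
theorem mem_of_adj (h : Invariant off S C) {x y : Point} (hx : x ∈ C.Se)
    (hx' : x ∉ C.shape) (hxy : grid.Adj x y) : y ∈ C.Se := by
  by_contra hy
  obtain ⟨q, hq⟩ := h.boundary x hx y hy hxy
  exact hx' ⟨q, Or.inl hq.symm⟩

theorem mem_view_iff (h : Invariant off S C) (p : P) {x : Point}
    (hx : grid.Adj (C.state p).head x) : x ∈ C.view off p ↔ x ∈ C.Se := by
  constructor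
  · rintro (rfl | ⟨i, hi, rfl⟩)
    · exact absurd rfl hx.ne
    · exact (h.flags p i).1 hi
  · intro hxS
    obtain ⟨i, rfl⟩ := exists_viaPort_eq off p hx
    exact Or.inr ⟨i, (h.flags p i).2 hxS, rfl⟩

/-- Redundancy involves only the neighbors of the point, and on these the flags agree with the
eligible set. Absence of holes plays no role. -/
theorem conn_erode (h : Invariant off S C) (hp : (C.state p).head ∈ C.Se)
    (hsce : IsSCE (C.view off p) (C.state p).head) :
    CutConnected (C.Se \ {(C.state p).head}) := by
  refine h.conn.diff_singleton ⟨hp, ?_⟩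
  have : {u | u ∈ C.Se ∧ grid.Adj (C.state p).head u} =
      {u | u ∈ C.view off p ∧ grid.Adj (C.state p).head u} := by
    ext u
    exact and_congr_left fun hu => (h.mem_view_iff p hu).symm
  rw [this]
  exact hsce.1.1.2

/-- The two points adjacent to both `v` and its empty neighbor are eligible, giving three
consecutive eligible neighbors of `v`. -/
theorem mem_of_empty_neighbor (h : Invariant off S C) {v : Point} {d : Fin 6}
    (hd : v + dir d ∈ C.Se) (hd' : v + dir d ∉ C.shape) :
    v + dir (d - 1) ∈ C.Se ∧ v + dir (d + 1) ∈ C.Se :=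
  ⟨h.mem_of_adj hd hd' (adj_add_dir v d).1, h.mem_of_adj hd hd' (adj_add_dir v d).2⟩

/-- An SCE point has at most one empty eligible neighbor. -/
theorem empty_neighbor_unique (h : Invariant off S C)
    (hsce : IsSCE (C.view off p) (C.state p).head) {x y : Point}
    (hx : x ∈ C.Se) (hx' : x ∉ C.shape) (hvx : grid.Adj (C.state p).head x)
    (hy : y ∈ C.Se) (hy' : y ∉ C.shape) (hvy : grid.Adj (C.state p).head y) : x = y := by
  obtain ⟨c, hc⟩ := hsce.eq_of_three_neighbors
  have key : ∀ d, (C.state p).head + dir d ∈ C.Se → (C.state p).head + dir d ∉ C.shape →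
      d = c := fun d hd hd' =>
    hc d ((h.mem_view_iff p ⟨_, rfl⟩).2 (h.mem_of_empty_neighbor hd hd').1)
      ((h.mem_view_iff p ⟨_, rfl⟩).2 hd)
      ((h.mem_view_iff p ⟨_, rfl⟩).2 (h.mem_of_empty_neighbor hd hd').2)
  obtain ⟨d, rfl⟩ := hvx
  obtain ⟨e, rfl⟩ := hvy
  rw [key d hx hx', key e hy hy']

/-- An undecided particle excludes a leader. -/
theorem status_ne_leader (h : Invariant off S C) (hund : (C.state p).status = Status.undecided)
    (q : P) : (C.state q).status ≠ Status.leader := by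
  intro hq
  have hmem := h.undecided p hund
  rw [h.leader q hq] at hmem
  have := h.injective p q hmem
  subst this
  rw [hund] at hq
  cases hq

theorem contract [DecidableEq P] (h : Invariant off S C) (p : P) :
    Invariant off S
      { C with
          state := Function.update C.state p
            { C.state p with tail := (C.state p).head } } := by
  set s' : P → ParticleState := Function.update C.state p
    { C.state p with tail := (C.state p).head } with hs
  have hsame : ∀ q, (s' q).head = (C.state q).head ∧ (s' q).eligible = (C.state q).eligible ∧
      (s' q).status = (C.state q).status ∧ (s' q).terminated = (C.state q).terminated ∧
      ((s' q).tail = (C.state q).head ∨ (s' q).tail = (C.state q).tail) := by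
    intro q
    by_cases hq : q = p
    · subst hq; simp [hs]
    · simp [hs, hq]
  choose hhead hel hst hter htail using hsame
  constructor <;> simp only [hhead, hel, hst, hter, ParticleState.Contracted]
  · exact h.conn
  · exact h.subset
  · exact h.flags
  · exact h.boundary
  · intro q hq
    rcases htail q with e | e
    · exact e.symm
    · rw [e] at hq ⊢; exact h.tail q hq
  · exact h.injective
  · exact h.undecided
  · exact h.leader
  · exact h.follower
  · exact h.occupied
  · intro q hq
    rcases htail q with e | e
    · exact e.symm
    · rw [e]; exact h.contracted q hq
  · exact h.terminated
  · exact h.head_mem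
  · intro q
    rcases htail q with e | e
    · rw [e]; exact h.head_mem q
    · rw [e]; exact h.tail_mem q

theorem terminate [DecidableEq P] (h : Invariant off S C)
    (hdec : (C.state p).status ≠ Status.undecided) :
    Invariant off S
      { C with state := Function.update C.state p { C.state p with terminated := true } } := by
  set s' : P → ParticleState := Function.update C.state p
    { C.state p with terminated := true } with hs
  have hsame : ∀ q, (s' q).head = (C.state q).head ∧ (s' q).tail = (C.state q).tail ∧
      (s' q).eligible = (C.state q).eligible ∧ (s' q).status = (C.state q).status ∧
      (q ≠ p → (s' q).terminated = (C.state q).terminated) := by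
    intro q
    by_cases hq : q = p
    · subst hq; simp [hs]
    · simp [hs, hq]
  choose hhead htail hel hst hter using hsame
  constructor <;> simp only [hhead, hel, hst, htail, ParticleState.Contracted]
  · exact h.conn
  · exact h.subset
  · exact h.flags
  · exact h.boundary
  · exact h.tail
  · exact h.injective
  · exact h.undecided
  · exact h.leader
  · exact h.follower
  · exact h.occupied
  · exact h.contracted
  · intro q hq
    by_cases hqp : q = p
    · exact hqp ▸ hdec
    · exact h.terminated q (hter q hqp ▸ hq)
  · exact h.head_mem
  · exact h.tail_mem

theorem elect [DecidableEq P] (h : Invariant off S C) (hcon : (C.state p).Contracted)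
    (hund : (C.state p).status = Status.undecided)
    (hno : ∀ i, (C.state p).eligible i = false) :
    Invariant off S
      { C with
          state := Function.update C.state p { C.state p with status := Status.leader } } := by
  set s' : P → ParticleState := Function.update C.state p
    { C.state p with status := Status.leader } with hs
  have hsame : ∀ q, (s' q).head = (C.state q).head ∧ (s' q).tail = (C.state q).tail ∧
      (s' q).eligible = (C.state q).eligible ∧ (s' q).terminated = (C.state q).terminated ∧
      (q ≠ p → (s' q).status = (C.state q).status) := by
    intro q
    by_cases hq : q = p
    · subst hq; simp [hs]
    · simp [hs, hq]
  choose hhead htail hel hter hst using hsame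
  have hstp : (s' p).status = Status.leader := by simp [hs]
  have hmem := h.undecided p hund
  -- With no eligible neighbor, the singleton is closed under adjacency, so it exhausts the
  -- connected eligible set.
  have hSe : C.Se = {(C.state p).head} := by
    refine Set.Subset.antisymm (h.conn _ ⟨_, hmem, rfl⟩ ?_) (by simpa using hmem)
    rintro x - rfl y hy hxy
    obtain ⟨i, rfl⟩ := exists_viaPort_eq off p hxy
    have := (h.flags p i).2 hy
    rw [hno] at this
    cases this
  constructor <;> simp only [hhead, hel, hter, htail, ParticleState.Contracted]
  · exact h.conn
  · exact h.subset
  · exact h.flags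
  · exact h.boundary
  · exact h.tail
  · exact h.injective
  · intro q hq
    by_cases hqp : q = p
    · exact hqp ▸ hmem
    · exact h.undecided q (hst q hqp ▸ hq)
  · intro q hq
    by_cases hqp : q = p
    · exact hqp ▸ hSe
    · exact h.leader q (hst q hqp ▸ hq)
  · intro q hq
    by_cases hqp : q = p
    · subst hqp
      rw [hstp] at hq
      cases hq
    · exact h.follower q (hst q hqp ▸ hq)
  · exact h.occupied
  · intro q hq
    by_cases hqp : q = p
    · exact hqp ▸ hcon
    · exact h.contracted q (hst q hqp ▸ hq)
  · intro q hq
    by_cases hqp : q = p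
    · subst hqp
      rw [hstp]
      exact Status.noConfusion
    · exact hst q hqp ▸ h.terminated q hq
  · exact h.head_mem
  · exact h.tail_mem

/-- The point of an undecided contracted particle is erased; the particle stays as a follower, or
moves to an empty eligible point. -/
theorem erode [DecidableEq P] (h : Invariant off S C)
    (hund : (C.state p).status = Status.undecided)
    (hyes : ∃ i, (C.state p).eligible i = true)
    (hsce : IsSCE (C.view off p) (C.state p).head) (s : ParticleState)
    (hflags : ∀ i, s.eligible i = true ↔
      viaPort off p s.head i ∈ C.Se \ {(C.state p).head})
    (hcover : ∀ x ∈ C.Se, grid.Adj (C.state p).head x →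
      s.head = x ∨ ∃ q, (C.state q).head = x)
    (htail : s.tail = (C.state p).head) (hter : s.terminated = false)
    (hs : s.head = (C.state p).head ∧ s.status = Status.follower ∨
      s.head ∈ C.Se ∧ s.head ∉ C.shape ∧ s.status = Status.undecided) :
    Invariant off S
      { state := Function.update (C.notify off p (C.state p).head) p s
        Se := C.Se \ {(C.state p).head} } := by
  have hmem := h.undecided p hund
  set v := (C.state p).head with hv
  set s' : P → ParticleState := Function.update (C.notify off p v) p s with hs'
  have hsp : s' p = s := by simp [hs']
  have hsame : ∀ q, q ≠ p → (s' q).head = (C.state q).head ∧ (s' q).tail = (C.state q).tail ∧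
      (s' q).status = (C.state q).status ∧ (s' q).terminated = (C.state q).terminated ∧
      ∀ i, (s' q).eligible i = true ↔ (C.state q).eligible i = true ∧
        viaPort off q (C.state q).head i ≠ v := by
    intro q hq
    have : s' q = C.notify off p v q := by simp [hs', hq]
    rw [this]
    exact ⟨C.notify_head v q, C.notify_tail v q, C.notify_status v q, C.notify_terminated v q,
      C.notify_eligible q⟩
  choose hhead htl hst htm hel using hsame
  have hne : ∀ q, q ≠ p → (C.state q).head ≠ v := fun q hq e => hq (h.injective q p e)
  -- Heads stay distinct: that of `p` is unchanged or moves to an unoccupied point.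
  have hhead_ne : ∀ q, q ≠ p → (C.state q).head ≠ s.head := by
    intro q hq e
    rcases hs with ⟨e', -⟩ | ⟨-, hout, -⟩
    · exact hne q hq (e.trans e')
    · exact hout ⟨q, Or.inl e.symm⟩
  -- Erasing `v` exposes its eligible neighbors, which must therefore all be heads afterwards.
  have hcover' : ∀ x ∈ C.Se, grid.Adj v x → ∃ q, (s' q).head = x := by
    intro x hx hvx
    rcases hcover x hx hvx with e | ⟨q, e⟩
    · exact ⟨p, by rw [hsp, e]⟩
    · have hqp : q ≠ p := by
        rintro rfl
        exact hvx.ne e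
      exact ⟨q, by rw [hhead q hqp, e]⟩
  constructor
  · exact h.conn_erode hmem hsce
  · exact Set.sdiff_subset.trans h.subset
  · intro q i
    by_cases hq : q = p
    · subst hq
      simp only [hsp]
      exact hflags i
    · simp only [hel q hq, hhead q hq, h.flags]
      rfl
  · rintro x ⟨hx, hxv⟩ y hy hxy
    by_cases hyv : y = v
    · exact hcover' x hx (hyv ▸ hxy.symm)
    · obtain ⟨q, hq⟩ := h.boundary x hx y (fun hyS => hy ⟨hyS, hyv⟩) hxy
      have hqp : q ≠ p := by
        rintro rfl
        exact hxv hq.symm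
      exact ⟨q, by rw [← hq]; exact hhead q hqp⟩
  · rintro q ⟨hq, hqv⟩
    by_cases hqp : q = p
    · subst hqp
      simp only [hsp] at hqv
      exact absurd htail hqv
    · simp only [hhead q hqp, htl q hqp] at hq ⊢
      exact h.tail q hq
  · intro q r hqr
    by_cases hq : q = p <;> by_cases hr : r = p
    · rw [hq, hr]
    · subst hq
      simp only [hsp, hhead r hr] at hqr
      exact absurd hqr.symm (hhead_ne r hr)
    · subst hr
      simp only [hsp, hhead q hq] at hqr
      exact absurd hqr (hhead_ne q hq)
    · simp only [hhead q hq, hhead r hr] at hqr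
      exact h.injective q r hqr
  · intro q hq
    by_cases hqp : q = p
    · subst hqp
      simp only [hsp] at hq ⊢
      rcases hs with ⟨-, e⟩ | ⟨h1, h2, -⟩
      · rw [e] at hq
        cases hq
      · exact ⟨h1, fun e => h2 ⟨q, Or.inl e⟩⟩
    · simp only [hst q hqp, hhead q hqp] at hq ⊢
      exact ⟨h.undecided q hq, hne q hqp⟩
  · intro q hq
    exfalso
    by_cases hqp : q = p
    · subst hqp
      simp only [hsp] at hq
      rcases hs with ⟨-, e⟩ | ⟨-, -, e⟩ <;> rw [e] at hq <;> cases hq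
    · simp only [hst q hqp] at hq
      exact h.status_ne_leader hund q hq
  · intro q hq
    by_cases hqp : q = p
    · subst hqp
      simp only [hsp] at hq ⊢
      rcases hs with ⟨e, -⟩ | ⟨-, -, e⟩
      · exact fun hm => hm.2 e
      · rw [e] at hq
        cases hq
    · simp only [hst q hqp, hhead q hqp] at hq ⊢
      exact fun hm => h.follower q hq hm.1
  -- An eligible neighbor of `v` survives the erasure, and it is a head by `hcover'`.
  · obtain ⟨i, hi⟩ := hyes
    have hadj := adj_viaPort off p v i
    have hS := (h.flags p i).1 hi
    obtain ⟨q, hq⟩ := hcover' _ hS hadj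
    exact ⟨q, by rw [hq]; exact ⟨hS, hadj.ne'⟩⟩
  · intro q hq
    by_cases hqp : q = p
    · subst hqp
      simp only [hsp] at hq ⊢
      rcases hs with ⟨e, -⟩ | ⟨-, -, e⟩
      · exact e.trans htail.symm
      · exact absurd e hq
    · simp only [hst q hqp, hhead q hqp, htl q hqp, ParticleState.Contracted] at hq ⊢
      exact h.contracted q hq
  · intro q hq
    by_cases hqp : q = p
    · subst hqp
      simp only [hsp, hter] at hq
      cases hq
    · simp only [hst q hqp, htm q hqp] at hq ⊢
      exact h.terminated q hq
  · intro q
    by_cases hqp : q = p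
    · subst hqp
      simp only [hsp]
      rcases hs with ⟨e, -⟩ | ⟨h1, -⟩
      · rw [e]
        exact h.head_mem q
      · exact h.subset h1
    · simp only [hhead q hqp]
      exact h.head_mem q
  · intro q
    by_cases hqp : q = p
    · subst hqp
      simp only [hsp, htail]
      exact h.head_mem q
    · simp only [htl q hqp]
      exact h.tail_mem q

theorem step (h : Invariant off S C) {C' : Config P} (hact : Activation off p C C') :
    Invariant off S C' := by
  classical
  cases hact with
  | final => exact h
  | wait => exact h
  | skip => exact h
  | contract => convert h.contract p
  | terminate _ _ hdec => convert h.terminate hdec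
  | elect _ hcon hund hno => convert h.elect hcon hund hno
  | erodeExpand hter hcon hund hyes hsce i hel hempty =>
    have hu := (h.flags p i).1 hel
    have hadj := adj_viaPort off p (C.state p).head i
    convert h.erode hund hyes hsce
      { C.state p with
        head := viaPort off p (C.state p).head i
        tail := (C.state p).head
        eligible := fun j => if j = i + 3 then false else true } ?_ ?_ rfl hter
        (Or.inr ⟨hu, hempty, hund⟩)
    · intro j
      -- All neighbors of the empty target are eligible except the erased `v`, which lies behind
      -- port `i + 3`; this justifies the reset flags.
      have hj := h.mem_of_adj hu hempty (adj_viaPort off p _ j)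
      simp [viaPort_viaPort_eq_iff, hj]
    · intro x hx hvx
      by_cases hxs : x ∈ C.shape
      · exact Or.inr (h.exists_head_of_mem_shape hx hxs)
      · exact Or.inl (h.empty_neighbor_unique hsce hu hempty hadj hx hxs hvx)
  | erodeStay hter hcon hund hyes hsce hocc =>
    convert h.erode hund hyes hsce { C.state p with status := Status.follower } ?_ ?_ hcon.symm hter
      (Or.inl ⟨rfl, rfl⟩)
    · intro i
      have := (adj_viaPort off p (C.state p).head i).ne'
      simp [h.flags, this]
    · intro x hx hvx
      obtain ⟨i, rfl⟩ := exists_viaPort_eq off p hvx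
      exact Or.inr (h.exists_head_of_mem_shape hx (hocc i ((h.flags p i).2 hx)))

end Invariant

/-! ### Executions -/

theorem Activation.Se_subset {C' : Config P} (hact : Activation off p C C') : C'.Se ⊆ C.Se := by
  cases hact <;> first | exact subset_rfl | exact Set.sdiff_subset

/-- Some follower, or some eligible point, is at distance `i` from `l`. -/
def Marked (C : Config P) (l : Point) (i : ℕ) : Prop :=
  (∃ x ∈ C.Se, grid.dist l x = i) ∨
    ∃ q, (C.state q).status = Status.follower ∧ grid.dist l (C.state q).head = i

/-- An activation does not change the position of a follower. -/
theorem Activation.follower {C' : Config P} (hact : Activation off p C C') {q : P}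
    (hq : (C.state q).status = Status.follower) :
    (C'.state q).status = Status.follower ∧ (C'.state q).head = (C.state q).head := by
  by_cases hqp : q = p
  · subst hqp
    cases hact <;> simp_all
  · cases hact <;> simp [hqp, hq, Config.notify_head, Config.notify_status]

/-- The heart of the argument: the last eligible point at distance `i` can only be erased by a
particle that stays there as a follower. -/
theorem Marked.step {S : Set Point} (h : Invariant off S C) {C' : Config P}
    (hact : Activation off p C C') {l : Point} (hl : l ∈ C'.Se) {i : ℕ} (hm : Marked C l i) :
    Marked C' l i := by
  rcases hm with ⟨x, hx, hxi⟩ | ⟨q, hq, hqi⟩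
  swap
  · have := hact.follower hq
    exact Or.inr ⟨q, this.1, this.2 ▸ hqi⟩
  by_cases hex : ∃ y ∈ C'.Se, grid.dist l y = i
  · exact Or.inl hex
  push Not at hex
  have hlt : ∀ y ∈ C'.Se, grid.dist l y < i := fun y hy => (h.step hact).conn.dist_lt hl hex hy
  have hxv : C'.Se = C.Se \ {(C.state p).head} → x = (C.state p).head := by
    intro hS
    by_contra hne
    exact hex x (hS ▸ ⟨hx, hne⟩) hxi
  cases hact with
  | final => exact absurd hxi (hex x hx)
  | wait => exact absurd hxi (hex x hx)
  | skip => exact absurd hxi (hex x hx)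
  | contract => exact absurd hxi (hex x hx)
  | terminate => exact absurd hxi (hex x hx)
  | elect => exact absurd hxi (hex x hx)
  | erodeStay =>
    have := hxv rfl
    exact Or.inr ⟨p, by simp, by simpa [← this] using hxi⟩
  | erodeExpand _ _ _ _ _ j hel hempty =>
    exfalso
    have hu := (h.flags p j).1 hel
    obtain ⟨h1, h2⟩ := h.mem_of_empty_neighbor hu hempty
    rw [← hxv rfl] at h1 h2 hu
    -- A neighbor of the erased point `x` differs from it, so it is still eligible and falls under
    -- `hlt`.
    have hlt' : ∀ d, x + dir d ∈ C.Se → hexNorm (x + dir d - l) < hexNorm (x - l) := by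
      intro d hd
      rw [← dist_eq_hexNorm, ← dist_eq_hexNorm, hxi]
      refine hlt _ ⟨hd, ?_⟩
      rw [← hxv rfl]
      simp [dir_ne_zero]
    have h1 := hlt' _ h1
    have h2 := hlt' _ h2
    have h3 := hlt' _ hu
    rw [add_sub_right_comm] at h1 h2 h3
    have := exists_hexNorm_le_add_dir (x - l) (off p + j)
    omega

theorem IsExecution.invariant {C : ℕ → Config P} {a : ℕ → P} (h : IsExecution off C a) (t : ℕ) :
    Invariant off (C 0).shape (C t) := by
  induction t with
  | zero => exact h.initial.invariant
  | succ t ih => exact ih.step (h.step t)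

theorem finite_shape [Finite P] (h : IsInitial off C) : C.shape.Finite := by
  rw [Config.shape_eq_range h.contracted]
  exact Set.finite_range _

/-- Eligible sets only shrink, so `l` is eligible at all earlier times. Initially, the connected
area contains both `l` and a point at distance equal to the eccentricity, so no intermediate
distance is missed. -/
theorem IsExecution.marked [Finite P] {C : ℕ → Config P} {a : ℕ → P} (h : IsExecution off C a)
    {l : Point} {i : ℕ} (hi : i ≤ gridEccentricity (C 0).shape l) (t : ℕ) (hl : l ∈ (C t).Se) :
    Marked (C t) l i := by
  induction t with
  | zero =>
    left
    by_contra hno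
    push Not at hno
    obtain ⟨x, hx, hxe⟩ :=
      exists_dist_eq_gridEccentricity (finite_shape h.initial) h.initial.nonempty l
    have hxS : x ∈ (C 0).Se := h.initial.Se ▸ Or.inl hx
    have := (h.invariant 0).conn.dist_lt hl hno hxS
    omega
  | succ t ih => exact (ih ((h.step t).Se_subset hl)).step (h.invariant t) (h.step t) hl

end Amoebot

theorem mainTheorem6 {P : Type*} [Finite P] (off : P → Fin 6)
    (C : ℕ → Amoebot.Config P) (a : ℕ → P) (hexec : Amoebot.IsExecution off C a)
    (T : ℕ) (hT : (C T).Terminated) :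
    ∃ (pl : P) (l : Amoebot.Point),
      (∀ q, ((C T).state q).status = Amoebot.Status.leader ↔ q = pl) ∧
      ((C T).state pl).occupied = {l} ∧
      (C T).Se = {l} ∧
      (∀ i ≤ Amoebot.gridEccentricity (C 0).shape l,
        ∃ p, ((C T).state p).Contracted ∧
          Amoebot.grid.dist l ((C T).state p).head = i) ∧
      (∀ p, ∀ x ∈ ((C T).state p).occupied,
        Amoebot.grid.dist l x ≤ Amoebot.gridEccentricity (C 0).shape l) := by
  have h := hexec.invariant T
  have hdec : ∀ q, ((C T).state q).status ≠ Amoebot.Status.undecided := fun q =>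
    h.terminated q (hT q)
  have hcon : ∀ q, ((C T).state q).Contracted := fun q => h.contracted q (hdec q)
  obtain ⟨pl, hpl⟩ := h.occupied
  have hlead : ((C T).state pl).status = Amoebot.Status.leader := by
    cases hst : ((C T).state pl).status with
    | undecided => exact absurd hst (hdec pl)
    | leader => rfl
    | follower => exact absurd hpl (h.follower pl hst)
  have hSe := h.leader pl hlead
  refine ⟨pl, ((C T).state pl).head, fun q => ⟨fun hq => ?_, fun hq => hq ▸ hlead⟩, ?_, hSe, ?_, ?_⟩
  · have := h.leader q hq
    rw [hSe, Set.singleton_eq_singleton_iff] at this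
    exact h.injective q pl this.symm
  · have : ((C T).state pl).head = ((C T).state pl).tail := hcon pl
    simp [Amoebot.ParticleState.occupied, ← this]
  · intro i hi
    -- The only eligible point left is that of the leader, so the witness is the leader or a
    -- follower.
    rcases hexec.marked hi T hpl with ⟨x, hx, hxi⟩ | ⟨q, -, hqi⟩
    · rw [hSe] at hx
      obtain rfl := hx
      exact ⟨pl, hcon pl, hxi⟩
    · exact ⟨q, hcon q, hqi⟩
  · rintro p x (rfl | rfl)
    · exact Amoebot.dist_le_gridEccentricity (Amoebot.finite_shape hexec.initial) _ (h.head_mem p)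
    · exact Amoebot.dist_le_gridEccentricity (Amoebot.finite_shape hexec.initial) _ (h.tail_mem p)
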